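/- Let $G$ be a non-empty triangle-free strongly regular graph on $n$ vertices, i.e. a finite simple triangle-free graph for which there are integers $k,a,b\ge 0$ such that $G$ is $k$-regular, any two adjacent vertices have exactly $a$ common neighbours, and any two distinct non-adjacent vertices have exactly $b$ common neighbours. Let $\mu_1\ge\mu_2\ge\dots\ge\mu_n$ be the eigenvalues of the adjacency matrix of $G$, listed with multiplicity. Then $$\mu_1+\mu_n\le 0.14\,n,$$ with equality if and only if $G$ is isomorphic to the Higman–Sims graph (the unique strongly regular graph with parameters $(n,k,a,b)=(100,22,0,6)$). -/

import Mathlib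

namespace SimpleGraph

/-- The eigenvalues of the adjacency matrix of a finite graph on `n` vertices, with multiplicity,
listed in non-increasing order `μ₁ ≥ μ₂ ≥ … ≥ μₙ` (indexed from `0` to `n - 1`). -/
noncomputable def adjEigenvalues {V : Type*} [Fintype V] [DecidableEq V] (G : SimpleGraph V)
    [DecidableRel G.Adj] : Fin (Fintype.card V) → ℝ :=
  Matrix.IsHermitian.eigenvalues₀ (A := G.adjMatrix ℝ)
    ((Matrix.conjTranspose_eq_transpose_of_trivial _).trans G.transpose_adjMatrix)

/-- The largest adjacency eigenvalue `μ₁` of a non-empty finite graph. -/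
noncomputable def adjEigenvalueFirst {V : Type*} [Fintype V] [DecidableEq V] [Nonempty V]
    (G : SimpleGraph V) [DecidableRel G.Adj] : ℝ :=
  G.adjEigenvalues ⟨0, Fintype.card_pos⟩

/-- The smallest adjacency eigenvalue `μₙ` of a non-empty finite graph on `n` vertices. -/
noncomputable def adjEigenvalueLast {V : Type*} [Fintype V] [DecidableEq V] [Nonempty V]
    (G : SimpleGraph V) [DecidableRel G.Adj] : ℝ :=
  G.adjEigenvalues ⟨Fintype.card V - 1, Nat.sub_one_lt Fintype.card_ne_zero⟩

/-- The (unsymmetrized) adjacency rule of the Higman–Sims graph in Hafner's model: the vertices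
are the triples `(i, x, y)` with a layer `i` among `0, 1, 2, 3` and `x`, `y` in `ℤ/5ℤ`. -/
def higmanSimsRel : Fin 4 × ZMod 5 × ZMod 5 → Fin 4 × ZMod 5 × ZMod 5 → Prop
  | (0, x, y), (0, x', y') => x = x' ∧ (y = y' + 1 ∨ y = y' - 1)
  | (1, x, y), (1, x', y') => x = x' ∧ (y = y' + 2 ∨ y = y' - 2)
  | (2, x, y), (2, x', y') => x = x' ∧ (y = y' + 1 ∨ y = y' - 1)
  | (3, x, y), (3, x', y') => x = x' ∧ (y = y' + 2 ∨ y = y' - 2)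
  | (0, x, y), (1, m, c) => y = m * x + c
  | (1, m, c), (2, A, B) => c = 2 * (m - A) ^ 2 + B
  | (2, A, B), (3, a, b) => B = 2 * A ^ 2 + 3 * A * a - a ^ 2 + b
  | (3, a, b), (0, x, y) => y = (x - a) ^ 2 + b
  | (0, x, y), (2, A, B) => y = 3 * x ^ 2 + A * x + B + 1 ∨ y = 3 * x ^ 2 + A * x + B - 1
  | (1, m, c), (3, a, b) => c = m ^ 2 - m * a + b + 2 ∨ c = m ^ 2 - m * a + b - 2
  | _, _ => False

instance : DecidableRel higmanSimsRel := fun u v => by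
  unfold higmanSimsRel
  split <;> infer_instance

/-- The Higman–Sims graph, the strongly regular graph with parameters `(100, 22, 0, 6)`. The
layers `0, 1` and the layers `2, 3` each induce a Hoffman–Singleton graph. -/
def higmanSimsGraph : SimpleGraph (Fin 4 × ZMod 5 × ZMod 5) :=
  SimpleGraph.fromRel higmanSimsRel

instance : DecidableRel higmanSimsGraph.Adj := fun u v =>
  inferInstanceAs (Decidable (u ≠ v ∧ (higmanSimsRel u v ∨ higmanSimsRel v u)))

end SimpleGraph

/-! After degenerate cases are set aside, the eigenvalues lie in `{k, r, s}`, where `r` and `s = -b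
- r` are the roots of `x² + bx = k - b`. The quantity to bound is thus `k - b - r`, while counting
paths of length two gives `bn = b + bk + k(k - 1)`. The missing ingredient is the Krein condition `b
≤ r² + r` (`IsSRGWith.krein`). It holds because the entrywise cube of a positive multiple of a
projection has nonnegative entry sum, which `sum_pow_three_of_mul_self_eq_smul` exhibits as a sum of
squares. For `r ≥ 2` the bound becomes a polynomial inequality, tight only at `r = 2`, `b = 6`, that
is, for parameters `(100, 22, 0, 6)`; for `r < 2` finitely many pairs `(b, k)` remain.

For these parameters the sum of squares vanishes, so any three pairwise non-adjacent vertices have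
exactly two common neighbours (`IsSRGWith.card_common_three`). Hence the traces of the
non-neighbours of a vertex `x₀` on its 22 neighbours behave as the blocks of an `S(3, 6, 22)`. Such
a system can be coordinatized so that sixteen of its blocks are prescribed
(`IsSRGWith.exists_isFrame`). Every block meets these sixteen evenly, and at most 77 six-sets do so
(`card_hexads_le`). As `1 + 22 + 77 = 100`, all the candidates occur, and since adjacency can be
read off from traces, the graph is determined. A finite check shows that Hafner's model has the
right parameters. -/

open Finset Matrix

/-! ### Entrywise cubes of multiples of projections -/

namespace Matrix

variable {V : Type*} [Fintype V]

/-- The hypotheses say that `θ * F x y` is the inner product of rows `x` and `y`. Its cube is the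
inner product of the third tensor powers of these rows, so the total is the squared norm of the sum
of all these tensor powers. -/
theorem sum_pow_three_of_mul_self_eq_smul {F : Matrix V V ℝ} (hF : F.IsSymm) {θ : ℝ}
    (h : F * F = θ • F) :
    θ ^ 3 * ∑ x, ∑ y, F x y ^ 3
      = ∑ p : V × V × V, (∑ x, F x p.1 * F x p.2.1 * F x p.2.2) ^ 2 := by
  have key (x y : V) : θ ^ 3 * F x y ^ 3 = ∑ p : V × V × V,
      (F x p.1 * F x p.2.1 * F x p.2.2) * (F y p.1 * F y p.2.1 * F y p.2.2) := by
    have h1 : θ * F x y = ∑ z, F x z * F y z := by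
      have := congrFun (congrFun h x) y
      simp only [mul_apply, Matrix.smul_apply, smul_eq_mul] at this
      rw [← this]
      exact sum_congr rfl fun z _ => by rw [hF.apply y z]
    simp only [Fintype.sum_prod_type]
    rw [← mul_pow, h1, pow_succ', pow_two, sum_mul_sum, sum_mul_sum]
    refine sum_congr rfl fun a _ => ?_
    simp only [mul_sum]
    refine sum_congr rfl fun b _ => sum_congr rfl fun c _ => by ring
  simp only [mul_sum, key]
  rw [sum_congr rfl fun x _ => sum_comm, sum_comm]
  simp only [pow_two, sum_mul_sum]

end Matrix

/-! ### Spectrum of a triangle-free strongly regular graph -/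

namespace SimpleGraph

variable {V : Type*} [Fintype V] [DecidableEq V] {G : SimpleGraph V} [DecidableRel G.Adj]

theorem IsSRGWith.sum_adjMatrix_mul_adjMatrix {n k b : ℕ} (h : G.IsSRGWith n k 0 b) (x y : V) :
    ∑ z, G.adjMatrix ℝ x z * G.adjMatrix ℝ z y
      = (k - b) * (if x = y then 1 else 0) - b * G.adjMatrix ℝ x y + b := by
  have h1 := congrFun (congrFun (h.matrix_eq (α := ℝ)) x) y
  rw [pow_two, mul_apply] at h1
  rw [h1]
  simp only [Matrix.add_apply, Matrix.smul_apply, adjMatrix_apply, compl_adj, one_apply]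
  rcases eq_or_ne x y with rfl | hxy
  · simp
  · by_cases hA : G.Adj x y <;> simp [hA, hxy]

theorem IsSRGWith.sum_adjMatrix {n k a b : ℕ} (h : G.IsSRGWith n k a b) (x : V) :
    ∑ z, G.adjMatrix ℝ x z = k := by
  simp [adjMatrix_apply, ← h.regular x, degree, neighborFinset_eq_filter]

theorem isHermitian_adjMatrix_real (G : SimpleGraph V) [DecidableRel G.Adj] :
    (G.adjMatrix ℝ).IsHermitian :=
  (conjTranspose_eq_transpose_of_trivial _).trans G.transpose_adjMatrix

theorem eigenvalue_le_adjEigenvalueFirst [Nonempty V] (i : V) :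
    G.isHermitian_adjMatrix_real.eigenvalues i ≤ G.adjEigenvalueFirst :=
  G.isHermitian_adjMatrix_real.eigenvalues₀_antitone (by simp)

theorem adjEigenvalueLast_le_eigenvalue [Nonempty V] (i : V) :
    G.adjEigenvalueLast ≤ G.isHermitian_adjMatrix_real.eigenvalues i :=
  G.isHermitian_adjMatrix_real.eigenvalues₀_antitone (by
    rw [Fin.le_def]; exact Nat.le_sub_one_of_lt (Fin.is_lt _))

theorem exists_eigenvalue_eq (j : Fin (Fintype.card V)) :
    ∃ i, G.isHermitian_adjMatrix_real.eigenvalues i = G.adjEigenvalues j :=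
  ⟨Fintype.equivOfCardEq (Fintype.card_fin _) j, by simp [IsHermitian.eigenvalues, adjEigenvalues]⟩

/-- Summing `A v = l v` over all coordinates gives `k ∑ v = l ∑ v`. Either `l = k`, or `∑ v = 0` and
the all-ones term of `A²` annihilates `v`. -/
theorem IsSRGWith.eigenvalue_eq {n k b : ℕ} (h : G.IsSRGWith n k 0 b) (i : V) :
    let l := G.isHermitian_adjMatrix_real.eigenvalues i
    l = k ∨ l ^ 2 + b * l = k - b := by
  intro l
  set v : V → ℝ := ⇑(G.isHermitian_adjMatrix_real.eigenvectorBasis i) with hv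
  have hAv (x : V) : ∑ z, G.adjMatrix ℝ x z * v z = l * v x :=
    congrFun (G.isHermitian_adjMatrix_real.mulVec_eigenvectorBasis i) x
  have hsum : (k : ℝ) * ∑ x, v x = l * ∑ x, v x := by
    rw [mul_sum, mul_sum, sum_congr rfl fun x _ => (hAv x).symm, sum_comm]
    refine sum_congr rfl fun z _ => ?_
    rw [← sum_mul, ← h.sum_adjMatrix z]
    congr 1
    exact sum_congr rfl fun x _ => by simp [adjMatrix_apply, G.adj_comm]
  by_cases h0 : ∑ x, v x = 0
  · right
    obtain ⟨x, hx⟩ : ∃ x, v x ≠ 0 := by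
      by_contra! hc
      refine G.isHermitian_adjMatrix_real.eigenvectorBasis.toBasis.ne_zero i ?_
      ext x
      simpa using hc x
    have h2 : l * (l * v x) = (k - b) * v x - b * (l * v x) + b * ∑ x, v x := by
      calc l * (l * v x) = ∑ z, G.adjMatrix ℝ x z * (l * v z) := by
            rw [← hAv, mul_sum]; exact sum_congr rfl fun z _ => by ring
        _ = ∑ y, (∑ z, G.adjMatrix ℝ x z * G.adjMatrix ℝ z y) * v y := by
            simp_rw [← hAv, mul_sum, sum_mul]
            rw [sum_comm]
            exact sum_congr rfl fun z _ => sum_congr rfl fun y _ => by ring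
        _ = _ := by
            simp_rw [h.sum_adjMatrix_mul_adjMatrix, add_mul, sub_mul, sum_add_distrib,
              sum_sub_distrib, mul_assoc, ← mul_sum, hAv]
            simp
    rw [h0] at h2
    exact mul_right_cancel₀ hx (by linear_combination h2)
  · left
    exact (mul_right_cancel₀ h0 hsum).symm

theorem IsSRGWith.adjEigenvalueFirst_eq [Nonempty V] {n k b : ℕ} (h : G.IsSRGWith n k 0 b)
    (hk : 0 < k) : G.adjEigenvalueFirst = k := by
  have hk' : (1 : ℝ) ≤ k := mod_cast hk
  apply le_antisymm
  · obtain ⟨i, hi⟩ := exists_eigenvalue_eq (G := G) ⟨0, Fintype.card_pos⟩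
    change _ = G.adjEigenvalueFirst at hi
    rw [← hi]
    rcases h.eigenvalue_eq i with hl | hl
    · exact hl.le
    · have hb : (0 : ℝ) ≤ b := b.cast_nonneg
      by_contra! hc
      nlinarith
  · have hmem : (k : ℝ) ∈ spectrum ℝ (G.adjMatrix ℝ) := by
      rw [← spectrum_toLin', ← Module.End.hasEigenvalue_iff_mem_spectrum]
      refine Module.End.hasEigenvalue_of_hasEigenvector (x := fun _ => 1) ⟨?_, ?_⟩
      · rw [Module.End.mem_eigenspace_iff]
        ext x
        simpa [mulVec, dotProduct] using h.sum_adjMatrix x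
      · exact fun h0 => one_ne_zero (congrFun h0 (Classical.arbitrary V))
    rw [G.isHermitian_adjMatrix_real.spectrum_real_eq_range_eigenvalues] at hmem
    obtain ⟨i, hi⟩ := hmem
    exact hi ▸ eigenvalue_le_adjEigenvalueFirst i

theorem IsSRGWith.adjEigenvalueLast_eq [Nonempty V] {n k b : ℕ} (h : G.IsSRGWith n k 0 b)
    (hk : 0 < k) : G.adjEigenvalueLast < 0 ∧
      G.adjEigenvalueLast ^ 2 + b * G.adjEigenvalueLast = k - b := by
  have hk' : (0 : ℝ) < k := mod_cast hk
  obtain ⟨i, hi⟩ := exists_eigenvalue_eq (G := G) 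
    ⟨Fintype.card V - 1, Nat.sub_one_lt Fintype.card_ne_zero⟩
  change _ = G.adjEigenvalueLast at hi
  have hneg : G.adjEigenvalueLast < 0 := by
    -- The trace is zero, so nonnegative eigenvalues would all vanish, although `k > 0` is one of
    -- them.
    by_contra! h0
    have htr := G.isHermitian_adjMatrix_real.trace_eq_sum_eigenvalues
    rw [trace_adjMatrix] at htr
    have hz : ∀ i, G.isHermitian_adjMatrix_real.eigenvalues i = 0 := by
      have := (sum_eq_zero_iff_of_nonneg (s := univ)
        (f := G.isHermitian_adjMatrix_real.eigenvalues)
        (fun i _ => h0.trans (adjEigenvalueLast_le_eigenvalue i))).1 (by simpa using htr.symm)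
      simpa using this
    obtain ⟨j, hj⟩ := exists_eigenvalue_eq (G := G) ⟨0, Fintype.card_pos⟩
    change _ = G.adjEigenvalueFirst at hj
    rw [h.adjEigenvalueFirst_eq hk, hz j] at hj
    exact hk'.ne hj
  refine ⟨hneg, ?_⟩
  rcases h.eigenvalue_eq i with hl | hl
  · linarith
  · rwa [hi] at hl

/-- Both sides come from counting the `k * k` walks of length two that start at a fixed vertex. -/
theorem IsSRGWith.real_param_eq [Nonempty V] {n k b : ℕ} (h : G.IsSRGWith n k 0 b) :
    (b * n : ℝ) = b + b * k + k * (k - 1) := by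
  have x := Classical.arbitrary V
  have h1 : ∑ y, ∑ z, G.adjMatrix ℝ x z * G.adjMatrix ℝ z y = k * k := by
    rw [sum_comm]
    simp_rw [← mul_sum, h.sum_adjMatrix, ← sum_mul, h.sum_adjMatrix]
  simp_rw [h.sum_adjMatrix_mul_adjMatrix, sum_add_distrib, sum_sub_distrib, ← mul_sum,
    h.sum_adjMatrix] at h1
  simp [h.card] at h1
  linear_combination h1

/-! ### The Krein condition -/

/-- A multiple of the projection onto the eigenspace of the smallest eigenvalue, when `r` is the
second largest eigenvalue and `c` is chosen suitably. -/
def shiftedAdjMatrix (G : SimpleGraph V) [DecidableRel G.Adj] (r c : ℝ) : Matrix V V ℝ :=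
  of fun x y => r * (if x = y then 1 else 0) - G.adjMatrix ℝ x y + c

theorem IsSRGWith.sum_shiftedAdjMatrix_pow_three [Nonempty V] {n k b : ℕ} (h : G.IsSRGWith n k 0 b)
    {r c : ℝ} (hr : r ^ 2 + b * r = k - b) (hc : c * (k + r + b) = b) (hn : c * n = k - r) :
    (2 * r + b) ^ 3 * (n * ((r + c) ^ 3 + k * (c - 1) ^ 3 + (n - 1 - k) * c ^ 3))
      = ∑ p : V × V × V, (∑ x, G.shiftedAdjMatrix r c x p.1 * G.shiftedAdjMatrix r c x p.2.1 *
          G.shiftedAdjMatrix r c x p.2.2) ^ 2 := by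
  have hsymm : (G.shiftedAdjMatrix r c).IsSymm := by
    ext x y
    simp [shiftedAdjMatrix, adjMatrix_apply, G.adj_comm, eq_comm]
  have hA (x y : V) : G.adjMatrix ℝ x y = G.adjMatrix ℝ y x := by
    simp [adjMatrix_apply, G.adj_comm]
  have hcol (y : V) : ∑ z, G.adjMatrix ℝ z y = k := by
    rw [← h.sum_adjMatrix y]
    exact sum_congr rfl fun z _ => hA z y
  have hsq : G.shiftedAdjMatrix r c * G.shiftedAdjMatrix r c
      = (2 * r + b) • G.shiftedAdjMatrix r c := by
    ext x y
    simp only [mul_apply, shiftedAdjMatrix, of_apply, Matrix.smul_apply, smul_eq_mul]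
    have : ∀ z, (r * (if x = z then 1 else 0) - G.adjMatrix ℝ x z + c) *
        (r * (if z = y then 1 else 0) - G.adjMatrix ℝ z y + c)
        = G.adjMatrix ℝ x z * G.adjMatrix ℝ z y
          + (if x = z then r * (r * (if z = y then 1 else 0) - G.adjMatrix ℝ z y + c) else 0)
          + (if z = y then r * (c - G.adjMatrix ℝ x z) else 0)
          - c * G.adjMatrix ℝ x z - c * G.adjMatrix ℝ z y + c * c := by
      intro z
      split_ifs <;> ring
    simp_rw [this, sum_add_distrib, sum_sub_distrib, sum_add_distrib, ← mul_sum, hcol,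
      h.sum_adjMatrix, h.sum_adjMatrix_mul_adjMatrix]
    simp only [sum_ite_eq, sum_ite_eq', mem_univ, if_true, sum_const, card_univ, h.card,
      nsmul_eq_mul]
    linear_combination (-(if x = y then (1 : ℝ) else 0)) * hr - hc + c * hn
  rw [← sum_pow_three_of_mul_self_eq_smul hsymm hsq]
  congr 1
  have hrow (x : V) : ∑ y, G.shiftedAdjMatrix r c x y ^ 3
      = (r + c) ^ 3 + k * (c - 1) ^ 3 + (n - 1 - k) * c ^ 3 := by
    have : ∀ y, G.shiftedAdjMatrix r c x y ^ 3 = (if x = y then (r + c) ^ 3 - c ^ 3 else 0)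
        + ((c - 1) ^ 3 - c ^ 3) * G.adjMatrix ℝ x y + c ^ 3 := by
      intro y
      rcases eq_or_ne x y with rfl | hxy
      · simp [shiftedAdjMatrix]
      · by_cases ha : G.Adj x y <;> simp [shiftedAdjMatrix, hxy, ha]
        ring
    simp_rw [this, sum_add_distrib, ← mul_sum, h.sum_adjMatrix]
    simp [h.card]
    ring
  simp only [hrow, sum_const, card_univ, h.card, nsmul_eq_mul]

/-- The Krein condition for a triangle-free strongly regular graph with second largest
eigenvalue `r`. -/
theorem IsSRGWith.krein [Nonempty V] {n k b : ℕ} (h : G.IsSRGWith n k 0 b) {r : ℝ} (hr0 : 0 < r)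
    (hb : 0 < b) (hr : r ^ 2 + b * r = k - b) : (b : ℝ) ≤ r ^ 2 + r := by
  have hb1 : (1 : ℝ) ≤ b := mod_cast hb
  have hn := h.real_param_eq
  have hk : (k : ℝ) = r ^ 2 + b * r + b := by linarith
  have hk0 : (0 : ℝ) < k := by rw [hk]; positivity
  have hn0 : (0 : ℝ) < n := by
    rw [← h.card]; exact_mod_cast Fintype.card_pos
  have hD : (0 : ℝ) < k + r + b := by positivity
  -- This `c` makes the row sums `r - k + c * n` vanish, since `b * n = (k - r) * (k + r + b)`.
  set c : ℝ := b / (k + r + b) with hcdef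
  have hc : c * (k + r + b) = b := div_mul_cancel₀ _ hD.ne'
  have hcn : c * n = k - r := by
    rw [hcdef, div_mul_eq_mul_div, div_eq_iff hD.ne', hn]
    linear_combination hr
  have key := h.sum_shiftedAdjMatrix_pow_three hr hc hcn
  have h1 : 0 ≤ (r + c) ^ 3 + k * (c - 1) ^ 3 + (n - 1 - k) * c ^ 3 := by
    have h2 : 0 ≤ ((2 * r + b) ^ 3 * n) *
        ((r + c) ^ 3 + k * (c - 1) ^ 3 + (n - 1 - k) * c ^ 3) := by
      rw [mul_assoc, key]
      exact sum_nonneg fun p _ => sq_nonneg _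
    exact nonneg_of_mul_nonneg_right h2 (by positivity)
  have h3 : 0 ≤ (k * (r + 1)) * ((r + 1) ^ 2 * k ^ 2 - (r + 1) ^ 2 * (b + r) ^ 3
      + (b + r - 1) * b ^ 2) := by
    have h4 : (k * (r + 1)) * ((r + 1) ^ 2 * k ^ 2 - (r + 1) ^ 2 * (b + r) ^ 3
      + (b + r - 1) * b ^ 2)
      = ((r + c) ^ 3 + k * (c - 1) ^ 3 + (n - 1 - k) * c ^ 3) * (k + r + b) ^ 3 := by
      have e1 : (r + c) * (k + r + b) = (r + 1) * k := by linear_combination hc + hr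
      have e2 : (c - 1) * (k + r + b) = -((r + 1) * (b + r)) := by linear_combination hc + hr
      have e3 : (n - 1 - k) * b = k * ((r + 1) * (b + r - 1)) := by
        linear_combination hn - k * hr
      calc _ = ((r + 1) * k) ^ 3 + k * (-((r + 1) * (b + r))) ^ 3
            + ((k : ℝ) * ((r + 1) * (b + r - 1))) * b ^ 2 := by ring
        _ = ((r + c) * (k + r + b)) ^ 3 + k * ((c - 1) * (k + r + b)) ^ 3
            + (n - 1 - k) * (c * (k + r + b)) ^ 3 := by rw [e1, e2, ← e3, hc]; ring
        _ = _ := by ring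
    rw [h4]
    positivity
  have h5 := nonneg_of_mul_nonneg_right h3 (by positivity)
  -- Once `k` is eliminated, the Krein expression factors, and `r ^ 2 + r - b` is the only factor of
  -- undetermined sign.
  have h6 : (r + 1) ^ 2 * k ^ 2 - (r + 1) ^ 2 * (b + r) ^ 3 + (b + r - 1) * b ^ 2
      = ((b + r - 1) * r * ((r + 2) * (b + r) - r)) * (r ^ 2 + r - b) := by
    rw [hk]; ring
  rw [h6] at h5
  have h7 : 0 < (b + r - 1) * r * ((r + 2) * (b + r) - r) := by
    have : 0 < b + r - 1 := by linarith
    have : 0 < (r + 2) * (b + r) - r := by nlinarith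
    positivity
  linarith [nonneg_of_mul_nonneg_right h5 h7]

/-! ### The inequality between the parameters -/

theorem srg_params_of_two_le {n k b r : ℝ} (hr2 : 2 ≤ r) (hb : 1 ≤ b)
    (hr : r ^ 2 + b * r = k - b) (hn : b * n = b + b * k + k * (k - 1))
    (hkrein : b ≤ r ^ 2 + r) :
    k - b - r ≤ 0.14 * n ∧ (k - b - r = 0.14 * n → r = 2 ∧ b = 6) := by
  obtain rfl : k = r ^ 2 + b * r + b := by linarith
  set P : ℝ := b * (7 * n - 50 * (r ^ 2 + b * r - r)) with hP
  set L : ℝ := 7 * r ^ 2 - 29 * r + 14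
  have key : P = L * (b + r) ^ 2 + (29 * r ^ 2 + 15 * r) * (b + r) - 36 * r ^ 2 := by
    simp only [hP, L]; linear_combination 7 * hn
  have hpos : 0 ≤ P ∧ (P = 0 → r = 2 ∧ b = 6) := by
    -- `L` is the leading coefficient of `P` as a quadratic in `b`. If it is not positive, `P` is
    -- concave, and `hid` compares it with its chord over `0 ≤ b ≤ r ^ 2 + r`, whose end values are
    -- nonnegative for `r ≥ 2`.
    rcases le_total 0 L with hL | hL
    · have : 0 < P := by
        rw [key]
        have : 0 ≤ L * (b + r) ^ 2 := by positivity
        nlinarith [sq_nonneg r, mul_pos (show 0 < r by linarith) (show 0 < r by linarith)]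
      exact ⟨this.le, fun h => absurd h this.ne'⟩
    · have hid : P * (r ^ 2 + r) = (-L) * b * (r ^ 2 + r - b) * (r ^ 2 + r)
          + (7 * r ^ 2 * (r - 1) * (r + 1)) * (r ^ 2 + r - b)
          + (r ^ 2 * (r + 1) * (r - 2) * (7 * r ^ 2 + 6 * r - 25)) * b := by
        rw [key]; simp only [L]; ring
      have h1 : 0 ≤ (-L) * b * (r ^ 2 + r - b) * (r ^ 2 + r) := by
        have : 0 ≤ -L := by linarith
        have : 0 ≤ r ^ 2 + r - b := by linarith
        positivity
      have hq : 0 < 7 * r ^ 2 * (r - 1) * (r + 1) := by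
        have : 0 < r - 1 := by linarith
        positivity
      have h2 : 0 ≤ (7 * r ^ 2 * (r - 1) * (r + 1)) * (r ^ 2 + r - b) :=
        mul_nonneg hq.le (by linarith)
      have hs : 0 < r ^ 2 * (r + 1) * (7 * r ^ 2 + 6 * r - 25) * b := by
        have : 0 < 7 * r ^ 2 + 6 * r - 25 := by nlinarith
        positivity
      have h3 : 0 ≤ (r ^ 2 * (r + 1) * (r - 2) * (7 * r ^ 2 + 6 * r - 25)) * b := by
        have := mul_nonneg hs.le (sub_nonneg.2 hr2)
        linarith
      have hrr : 0 < r ^ 2 + r := by positivity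
      refine ⟨nonneg_of_mul_nonneg_left (by linarith) hrr, fun h0 => ?_⟩
      rw [h0, zero_mul] at hid
      have e2 : (7 * r ^ 2 * (r - 1) * (r + 1)) * (r ^ 2 + r - b) = 0 := by linarith
      have e3 : (r ^ 2 * (r + 1) * (7 * r ^ 2 + 6 * r - 25) * b) * (r - 2) = 0 := by linarith
      have hr' : r = 2 := by
        linarith [(mul_eq_zero.1 e3).resolve_left hs.ne']
      have := (mul_eq_zero.1 e2).resolve_left hq.ne'
      subst hr'
      exact ⟨rfl, by linarith⟩
  have hb0 : 0 < b := by linarith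
  constructor
  · have := nonneg_of_mul_nonneg_right hpos.1 hb0
    linarith
  · intro he
    refine hpos.2 ?_
    have : 7 * n - 50 * (r ^ 2 + b * r - r) = 0 := by linarith
    rw [hP, this, mul_zero]

theorem srg_params_of_lt_two {n k b : ℕ} {r : ℝ} (hr0 : 0 < r) (hr2 : r < 2) (hb : 1 ≤ b)
    (hr : r ^ 2 + b * r = k - b) (hn : (b * n : ℝ) = b + b * k + k * (k - 1))
    (hkrein : (b : ℝ) ≤ r ^ 2 + r) : (k : ℝ) - b - r < 0.14 * n := by
  have hb1 : (1 : ℝ) ≤ b := mod_cast hb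
  have hb6 : b < 6 := by
    have : (b : ℝ) < 6 := by nlinarith
    exact_mod_cast this
  have hk : k < 3 * b + 4 := by
    have : (k : ℝ) < 3 * b + 4 := by nlinarith
    exact_mod_cast this
  have hkb : b < k := by
    have : (b : ℝ) < k := by nlinarith [mul_pos (lt_of_lt_of_le one_pos hb1) hr0]
    exact_mod_cast this
  have hn' : b * n + k = b + b * k + k * k := by
    have : ((b * n + k : ℕ) : ℝ) = (b + b * k + k * k : ℕ) := by
      push_cast; linear_combination hn
    exact_mod_cast this
  -- `omega` discards the pairs for which no natural number `n` satisfies `hn'`.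
  interval_cases b <;> interval_cases k <;> try omega
  all_goals
    clear hn' hkb hk hb6 hb1 hb
    norm_num at hn hr hkrein ⊢
    by_contra! hc
    nlinarith

theorem IsSRGWith.adjEigenvalueFirst_add_adjEigenvalueLast_le [Nonempty V] {n k b : ℕ}
    (h : G.IsSRGWith n k 0 b) (hbk : b ≤ k) :
    G.adjEigenvalueFirst + G.adjEigenvalueLast ≤ 0.14 * n ∧
      (G.adjEigenvalueFirst + G.adjEigenvalueLast = 0.14 * n → n = 100 ∧ k = 22 ∧ b = 6) := by
  have hn0 : (0 : ℝ) < n := by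
    rw [← h.card]; exact_mod_cast Fintype.card_pos
  have of_lt (hlt : G.adjEigenvalueFirst + G.adjEigenvalueLast < 0.14 * n) :
      G.adjEigenvalueFirst + G.adjEigenvalueLast ≤ 0.14 * n ∧
      (G.adjEigenvalueFirst + G.adjEigenvalueLast = 0.14 * n → n = 100 ∧ k = 22 ∧ b = 6) :=
    ⟨hlt.le, fun he => absurd he hlt.ne⟩
  have hnpos : 0 < 0.14 * (n : ℝ) := by positivity
  rcases k.eq_zero_or_pos with rfl | hk
  · obtain rfl : b = 0 := by omega
    have hz (j) : G.adjEigenvalues j = 0 := by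
      obtain ⟨i, hi⟩ := exists_eigenvalue_eq (G := G) j
      have := h.eigenvalue_eq i
      simp only [hi] at this
      simpa using this
    apply of_lt
    rw [adjEigenvalueFirst, adjEigenvalueLast, hz, hz]
    simpa using hnpos
  have hfirst := h.adjEigenvalueFirst_eq hk
  obtain ⟨hs0, hs⟩ := h.adjEigenvalueLast_eq hk
  have hparam := h.real_param_eq
  have hk1 : (1 : ℝ) ≤ k := mod_cast hk
  have hbk' : (b : ℝ) ≤ k := mod_cast hbk
  set s := G.adjEigenvalueLast
  rw [hfirst] at of_lt ⊢
  -- For `b = 0` the path count forces `k = 1`, a perfect matching, with extreme eigenvalues `1` and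
  -- `-1`.
  rcases b.eq_zero_or_pos with rfl | hb
  · have hk' : (k : ℝ) = 1 := by
      have : (k : ℝ) * (k - 1) = 0 := by simpa using hparam.symm
      linarith [(mul_eq_zero.1 this).resolve_left (by positivity)]
    apply of_lt
    have : s = -1 := by
      rw [hk'] at hs
      have : (s - 1) * (s + 1) = 0 := by push_cast at hs; linear_combination hs
      linarith [(mul_eq_zero.1 this).resolve_left (by linarith)]
    rw [this, hk']
    simpa using hnpos
  obtain ⟨r, hrs⟩ : ∃ r, s = -b - r := ⟨-b - s, by ring⟩
  have hb1 : (1 : ℝ) ≤ b := mod_cast hb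
  have hr : r ^ 2 + b * r = k - b := by rw [hrs] at hs; linear_combination hs
  have hr0 : 0 ≤ r := by
    have : r * s ≤ 0 := by rw [hrs]; linarith
    exact nonneg_of_mul_nonpos_left this hs0
  have hsum : (k : ℝ) + s = k - b - r := by rw [hrs]; ring
  rw [hsum] at of_lt ⊢
  rcases hr0.eq_or_lt with rfl | hr0
  · exact of_lt (by linarith)
  have hkrein := h.krein hr0 hb hr
  rcases lt_or_ge r 2 with hr2 | hr2
  · exact of_lt (srg_params_of_lt_two hr0 hr2 hb hr hparam hkrein)
  · obtain ⟨hle, heq⟩ := srg_params_of_two_le hr2 hb1 hr hparam hkrein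
    refine ⟨hle, fun he => ?_⟩
    obtain ⟨rfl, hb6⟩ := heq he
    rw [hb6] at hr hparam
    have hk22 : (k : ℝ) = 22 := by linarith
    rw [hk22] at hparam
    have hn100 : (n : ℝ) = 100 := by linarith
    exact ⟨mod_cast hn100, mod_cast hk22, mod_cast hb6⟩

theorem IsSRGWith.adjEigenvalueFirst_add_adjEigenvalueLast_eq [Nonempty V]
    (h : G.IsSRGWith 100 22 0 6) : G.adjEigenvalueFirst + G.adjEigenvalueLast = 14 := by
  obtain ⟨hs0, hs⟩ := h.adjEigenvalueLast_eq (by norm_num)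
  rw [h.adjEigenvalueFirst_eq (by norm_num)]
  have : (G.adjEigenvalueLast - 2) * (G.adjEigenvalueLast + 8) = 0 := by
    push_cast at hs; linear_combination hs
  push_cast
  linarith [(mul_eq_zero.1 this).resolve_left (by linarith)]

/-! ### Common neighbours -/

theorem card_commonNeighbors_eq_card_filter (x y : V) :
    Fintype.card (G.commonNeighbors x y) = #{z | G.Adj x z ∧ G.Adj y z} := by
  rw [← Set.toFinset_card]
  congr 1
  ext z
  simp [mem_commonNeighbors]

theorem IsSRGWith.exists_le_of_cliqueFree [Nonempty V] {n k a b : ℕ} (h : G.IsSRGWith n k a b)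
    (htri : G.CliqueFree 3) : ∃ b' ≤ k, G.IsSRGWith n k 0 b' := by
  have hadj (v w : V) (hvw : G.Adj v w) : Fintype.card (G.commonNeighbors v w) = 0 := by
    rw [card_commonNeighbors_eq_card_filter, card_eq_zero, filter_eq_empty_iff]
    rintro z - ⟨h1, h2⟩
    exact htri {v, w, z} (is3Clique_triple_iff.2 ⟨hvw, h1, h2⟩)
  by_cases hb : b ≤ k
  · exact ⟨b, hb, h.card, h.regular, hadj, h.of_not_adj⟩
  -- If `b > k`, no two distinct vertices are non-adjacent, so `b` is arbitrary and may be replaced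
  -- by `0`.
  · refine ⟨0, k.zero_le, h.card, h.regular, hadj, fun v w hvw hna => absurd ?_ hb⟩
    rw [← h.of_not_adj hvw hna, ← h.regular v]
    exact G.card_commonNeighbors_le_degree_left v w

theorem IsSRGWith.of_iso {W : Type*} [Fintype W] [DecidableEq W] {H : SimpleGraph W}
    [DecidableRel H.Adj] {n k a b : ℕ} (h : H.IsSRGWith n k a b) (e : G ≃g H) :
    G.IsSRGWith n k a b := by
  have hc (x y : V) : Fintype.card (G.commonNeighbors x y)
      = Fintype.card (H.commonNeighbors (e x) (e y)) := by
    rw [card_commonNeighbors_eq_card_filter, card_commonNeighbors_eq_card_filter]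
    exact card_equiv e.toEquiv fun z => by simp [e.map_adj_iff]
  refine ⟨(Fintype.card_congr e.toEquiv).trans h.card, fun x => ?_, fun x y hxy => ?_,
    fun x y hxy hn => ?_⟩
  · rw [← h.regular (e x)]
    exact (e.degree_eq x).symm
  · rw [hc, h.of_adj _ _ (e.map_adj_iff.2 hxy)]
  · rw [hc]
    exact h.of_not_adj (e.injective.ne hxy) (by simpa [e.map_adj_iff] using hn)

theorem IsSRGWith.not_adj_of_common {n k b : ℕ} (h : G.IsSRGWith n k 0 b) {x y z : V}
    (hx : G.Adj z x) (hy : G.Adj z y) : ¬ G.Adj x y := by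
  intro hxy
  have := h.of_adj x y hxy
  rw [card_commonNeighbors_eq_card_filter, card_eq_zero, filter_eq_empty_iff] at this
  exact this (mem_univ z) ⟨hx.symm, hy.symm⟩

theorem IsSRGWith.card_common_three [Nonempty V] (h : G.IsSRGWith 100 22 0 6) {x y z : V}
    (hxy : x ≠ y) (hxz : x ≠ z) (hyz : y ≠ z) (axy : ¬ G.Adj x y) (axz : ¬ G.Adj x z)
    (ayz : ¬ G.Adj y z) : #{w | G.Adj w x ∧ G.Adj w y ∧ G.Adj w z} = 2 := by
  have key := h.sum_shiftedAdjMatrix_pow_three (r := 2) (c := 1 / 5) (by norm_num) (by norm_num)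
    (by norm_num)
  norm_num at key
  -- Since `2.2³ - 22 * 0.8³ + 77 * 0.2³ = 0`, the Krein condition is tight and each square
  -- vanishes. The square at `(x, y, z)` yields a linear equation for the number sought.
  have h0 := (sum_eq_zero_iff_of_nonneg fun p _ => sq_nonneg _).1 key.symm (x, y, z) (mem_univ _)
  have h0 := pow_eq_zero_iff (two_ne_zero) |>.1 h0
  have hcol (y : V) : ∑ z, G.adjMatrix ℝ z y = 22 := by
    rw [show (22 : ℝ) = (22 : ℕ) by norm_num, ← h.sum_adjMatrix y]
    exact sum_congr rfl fun z _ => by simp [adjMatrix_apply, G.adj_comm]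
  have hcol2 {u v : V} (huv : u ≠ v) (auv : ¬ G.Adj u v) :
      ∑ w, G.adjMatrix ℝ w u * G.adjMatrix ℝ w v = 6 := by
    have := h.sum_adjMatrix_mul_adjMatrix u v
    simp only [huv, auv, adjMatrix_apply, if_false] at this
    norm_num at this
    rw [← this]
    simp only [adjMatrix_apply, G.adj_comm u]
    norm_num
  have hcard : ((#{w | G.Adj w x ∧ G.Adj w y ∧ G.Adj w z} : ℕ) : ℝ)
      = ∑ w, G.adjMatrix ℝ w x * G.adjMatrix ℝ w y * G.adjMatrix ℝ w z := by
    rw [card_filter]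
    push_cast
    refine sum_congr rfl fun w _ => ?_
    by_cases h1 : G.Adj w x <;> by_cases h2 : G.Adj w y <;> by_cases h3 : G.Adj w z <;>
      simp [h1, h2, h3]
  have hyx : ¬ G.Adj y x := fun h => axy h.symm
  have hzx : ¬ G.Adj z x := fun h => axz h.symm
  have hzy : ¬ G.Adj z y := fun h => ayz h.symm
  have expand (w : V) : G.shiftedAdjMatrix 2 (1 / 5) w x * G.shiftedAdjMatrix 2 (1 / 5) w y *
      G.shiftedAdjMatrix 2 (1 / 5) w z
      = 1 / 125 + (if w = x then 2 / 25 else 0) + (if w = y then 2 / 25 else 0)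
        + (if w = z then 2 / 25 else 0)
        - 1 / 25 * G.adjMatrix ℝ w x - 1 / 25 * G.adjMatrix ℝ w y - 1 / 25 * G.adjMatrix ℝ w z
        + 1 / 5 * (G.adjMatrix ℝ w x * G.adjMatrix ℝ w y)
        + 1 / 5 * (G.adjMatrix ℝ w x * G.adjMatrix ℝ w z)
        + 1 / 5 * (G.adjMatrix ℝ w y * G.adjMatrix ℝ w z)
        - G.adjMatrix ℝ w x * G.adjMatrix ℝ w y * G.adjMatrix ℝ w z := by
    simp only [shiftedAdjMatrix, of_apply]
    rcases eq_or_ne w x with rfl | h1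
    · simp [hxy, hxz, axy, axz]; norm_num
    rcases eq_or_ne w y with rfl | h2
    · simp [hxy.symm, hyz, hyx, ayz]; norm_num
    rcases eq_or_ne w z with rfl | h3
    · simp [hxz.symm, hyz.symm, hzx, hzy]; norm_num
    simp only [h1, h2, h3, if_false]
    ring
  simp_rw [expand, sum_sub_distrib, sum_add_distrib, sum_sub_distrib, sum_add_distrib, ← mul_sum,
    hcol, hcol2 hxy axy, hcol2 hxz axz, hcol2 hyz ayz, ← hcard] at h0
  simp [h.card] at h0
  have : ((#{w | G.Adj w x ∧ G.Adj w y ∧ G.Adj w z} : ℕ) : ℝ) = 2 := by linarith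
  exact_mod_cast this

end SimpleGraph

/-! ### Parameters of the Higman–Sims graph, by computation with binary rows -/

namespace SimpleGraph

/-- The position of a vertex of the Higman–Sims graph in lexicographic order. -/
def higmanSimsIndex (u : Fin 4 × ZMod 5 × ZMod 5) : ℕ :=
  25 * u.1.val + 5 * u.2.1.val + u.2.2.val

/-- The rows of the adjacency matrix of the Higman–Sims graph, as binary numerals. -/
def higmanSimsRows : List ℕ :=
  [636397953973339862103173890066, 44721874496243700944745791493, 89443748992487401889491582986,
   178887497984974803778983165972, 318199562560114369837530087433, 82324849966025083025520329280,
   163449237738023893321870475424, 326898474332314750111484739904, 653796912065172331190770729600,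
   41181163905624080904278245664, 99093328770198818425944426496, 159773003023767615603877090304,
   319546004868096531961663727616, 639092009735040177603092697088, 50146291610056994959346639872,
   635684709829745758865833132032, 42133646274184776220573597696, 84267291368929762512807985152,
   168534546139484379855467446272, 337030444394815461099244388352, 59501522030852216642470936576,
   80625730552153777097908682752, 161251461068532050571032526848, 322502885537606965129574875136,
   643769038818015129113002508288, 490703453125968298123033871393, 981406906251936596246067742786,
   695163213455118519004215513220, 122675863281500800255044886792, 245351726563001600510089773584,
   140830418131347403068194164801, 242085440631790305473174446210, 482934150114339375727413084420,
   965829614639344571435368646152, 703621539160704158498793064496, 259198234216160093858118582401,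
   480019156067585647522351285506, 958837885430410804888616569348, 688439960878291518733978964008,
   148805926085077751263609790544, 134363349628972284612486629633, 267526273697999105411650720258,
   496675198397182827661992468516, 954936778874958983608103223368, 681799562078412681011859293328,
   505741046605860288575366636033, 971906697580816076487551893538, 677400733828954005570660598852,
   126763777503064476703441062024, 253488907158833148230420730128, 99656628793064620356022905490,
   159737861955189837151719805221, 319475723910379639153426212426, 638951447820758187557999167668,
   49828899969976186014538044745, 168439936679009995325174261042, 336879873356903097942759623237,
   635382434349070530891205645482, 42728349727043828016287983956, 84219968339504997679230145161,
   644352777287799216425215333970, 59469781155702921366377638053, 80563421093557963494307483978,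
   161088194339820087694006068884, 322176388643899608745199880489, 178592345259840319186501030066,
   318771071457727663776688579909, 636342888502397615377742449290, 44648086886809154602852980020,
   89296172629920176635681253961, 82018686788039018165493352786, 164037336977737794091236267653,
   326874248395530123270679603498, 653711020090652158951042667092, 41009343394020054440530814121,
   458374066207914109452353, 916748131325079397106818, 661169935108524115822852,
   114593525295277827822088, 229187050555405610786864, 14516638173789891917776930,
   29033275194658313554923588, 20553215900420120944648328, 3629731392786703147221264,
   7258319087440836302210561, 464232387557117894569559120, 928464773997343081518729345,
   657675134936972955536855298, 116058114777857860544504324, 232116193779121347482402856,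
   14855299439435748485602773520, 29710562280531254731455139873, 21044983343215686855136780354,
   3713825431726001036565168260, 7427649719717874792020837640, 475368994272812391750526124546,
   950737951947249603180891341860, 673439383778585856602544539720, 118842248586073389788582908048,
   237684497136406212934352544001]

/-- The row of a vertex in the adjacency matrix of the Higman–Sims graph, as a binary numeral. -/
def higmanSimsRow (u : Fin 4 × ZMod 5 × ZMod 5) : ℕ :=
  higmanSimsRows.getD (higmanSimsIndex u) 0

theorem testBit_higmanSimsRow (i : Fin 4) (x y : ZMod 5) (j : Fin 4) (x' y' : ZMod 5) :
    (higmanSimsRow (i, x, y)).testBit (higmanSimsIndex (j, x', y')) ↔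
      higmanSimsGraph.Adj (i, x, y) (j, x', y') := by
  rw [higmanSimsGraph, fromRel_adj]
  revert x y x' y'
  fin_cases i <;> fin_cases j <;>
    simp only [higmanSimsRel, ne_eq, Prod.mk.injEq, Fin.zero_eta, Fin.mk_one, Fin.reduceFinMk,
      Fin.reduceEq, true_and, false_and, not_false_eq_true, or_false, false_or, zero_ne_one,
      one_ne_zero]
  all_goals decide +kernel

end SimpleGraph

namespace SimpleGraph

/-- The number of ones among the last `k` binary digits of `m`. -/
def countBits : ℕ → ℕ → ℕ
  | 0, _ => 0
  | k + 1, m => m % 2 + countBits k (m / 2)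

theorem countBits_eq_card (k m : ℕ) : countBits k m = #{i : Fin k | m.testBit i} := by
  induction k generalizing m with
  | zero => simp [countBits]
  | succ k ih =>
    rw [countBits, ih, Fin.card_filter_univ_succ]
    simp only [Fin.val_succ, Nat.testBit_add_one, Fin.val_zero, Nat.testBit_zero]
    rcases Nat.mod_two_eq_zero_or_one m with h | h <;> simp [h]
    ring

/-- Whether `m` has exactly `c` ones in binary, found by deleting the lowest one `c` times. -/
def hasOnes : ℕ → ℕ → Bool
  | 0, m => m == 0
  | c + 1, m => m != 0 && hasOnes c (m &&& (m - 1))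

theorem countBits_zero (k : ℕ) : countBits k 0 = 0 := by
  simp [countBits_eq_card]

/-- Passing from `m` to `m &&& (m - 1)` clears exactly the lowest one: the last digit if `m` is odd,
and a digit of `m / 2` if `m` is even. -/
theorem countBits_land_sub_one (k m : ℕ) (h0 : m ≠ 0) (hm : m < 2 ^ k) :
    countBits k m = countBits k (m &&& (m - 1)) + 1 := by
  induction k generalizing m with
  | zero => simp at hm; omega
  | succ k ih =>
    simp only [countBits, Nat.and_div_two]
    rw [pow_succ] at hm
    rcases Nat.mod_two_eq_zero_or_one m with h | h
    · have h1 : (m - 1) / 2 = m / 2 - 1 := by omega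
      have h2 : (m &&& (m - 1)) % 2 = 0 := by
        have := Nat.and_mod_two_eq_one (a := m) (b := m - 1)
        omega
      rw [h1, ih (m / 2) (by omega) (by omega), h2, h]
      ring
    · have h1 : (m - 1) / 2 = m / 2 := by omega
      have h2 : (m &&& (m - 1)) % 2 = 0 := by
        have := Nat.and_mod_two_eq_one (a := m) (b := m - 1)
        omega
      rw [h1, Nat.and_self, h2, h]
      ring

theorem countBits_eq_of_hasOnes {k c m : ℕ} (hm : m < 2 ^ k) (h : hasOnes c m) :
    countBits k m = c := by
  induction c generalizing m with
  | zero =>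
    obtain rfl : m = 0 := by simpa [hasOnes] using h
    exact countBits_zero k
  | succ c ih =>
    simp only [hasOnes, Bool.and_eq_true, bne_iff_ne] at h
    rw [countBits_land_sub_one k m h.1 hm, ih (Nat.and_le_left.trans_lt hm) h.2]

theorem higmanSimsIndex_lt (u : Fin 4 × ZMod 5 × ZMod 5) : higmanSimsIndex u < 100 := by
  have := u.1.isLt
  have := ZMod.val_lt u.2.1
  have := ZMod.val_lt u.2.2
  simp only [higmanSimsIndex]
  omega

/-- The vertices of the Higman–Sims graph in lexicographic order. -/
noncomputable def higmanSimsIndexEquiv : Fin 4 × ZMod 5 × ZMod 5 ≃ Fin 100 :=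
  Equiv.ofBijective (fun u => ⟨higmanSimsIndex u, higmanSimsIndex_lt u⟩) <| by
    rw [Fintype.bijective_iff_injective_and_card]
    refine ⟨fun u v huv => ?_, by simp [ZMod.card]⟩
    have h := Fin.val_eq_of_eq huv
    simp only [higmanSimsIndex] at h
    have := ZMod.val_lt u.2.1
    have := ZMod.val_lt u.2.2
    have := ZMod.val_lt v.2.1
    have := ZMod.val_lt v.2.2
    refine Prod.ext (Fin.ext (by omega))
      (Prod.ext (ZMod.val_injective 5 ?_) (ZMod.val_injective 5 ?_))
    · omega
    · omega

theorem card_filter_testBit_higmanSimsIndex (m : ℕ) :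
    #{u | m.testBit (higmanSimsIndex u)} = countBits 100 m := by
  rw [countBits_eq_card]
  exact card_equiv higmanSimsIndexEquiv fun u => by simp [higmanSimsIndexEquiv]

theorem higmanSimsGraph_adj_iff (u v : Fin 4 × ZMod 5 × ZMod 5) :
    higmanSimsGraph.Adj u v ↔ (higmanSimsRow u).testBit (higmanSimsIndex v) :=
  (testBit_higmanSimsRow u.1 u.2.1 u.2.2 v.1 v.2.1 v.2.2).symm

theorem hasOnes_higmanSimsRows : ∀ i < 100, higmanSimsRows.getD i 0 < 2 ^ 100 ∧
    hasOnes 22 (higmanSimsRows.getD i 0) := by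
  decide +kernel

theorem hasOnes_land_higmanSimsRows : ∀ i < 100, ∀ j < 100, i ≠ j →
    hasOnes (bif (higmanSimsRows.getD i 0).testBit j then 0 else 6)
      (higmanSimsRows.getD i 0 &&& higmanSimsRows.getD j 0) := by
  decide +kernel

theorem card_common_higmanSimsGraph {u v : Fin 4 × ZMod 5 × ZMod 5} (huv : u ≠ v) :
    Fintype.card (higmanSimsGraph.commonNeighbors u v)
      = if higmanSimsGraph.Adj u v then 0 else 6 := by
  have hne : higmanSimsIndex u ≠ higmanSimsIndex v := fun h =>
    huv (higmanSimsIndexEquiv.injective (Fin.ext h))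
  have h := countBits_eq_of_hasOnes
    (Nat.and_le_left.trans_lt (hasOnes_higmanSimsRows _ (higmanSimsIndex_lt u)).1)
    (hasOnes_land_higmanSimsRows _ (higmanSimsIndex_lt u) _ (higmanSimsIndex_lt v) hne)
  rw [← card_filter_testBit_higmanSimsIndex] at h
  rw [card_commonNeighbors_eq_card_filter]
  simp only [higmanSimsGraph_adj_iff, higmanSimsRow, ← Bool.and_eq_true, ← Nat.testBit_and]
  rw [h, Bool.cond_eq_ite]

theorem higmanSimsGraph_isSRGWith : higmanSimsGraph.IsSRGWith 100 22 0 6 := by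
  refine ⟨by simp [ZMod.card], fun u => ?_, fun u v huv => ?_, fun u v huv hn => ?_⟩
  · have h := hasOnes_higmanSimsRows _ (higmanSimsIndex_lt u)
    rw [← countBits_eq_of_hasOnes h.1 h.2, ← card_filter_testBit_higmanSimsIndex, degree,
      neighborFinset_eq_filter]
    simp only [higmanSimsGraph_adj_iff, higmanSimsRow]
  · rw [card_common_higmanSimsGraph huv.ne, if_pos huv]
  · rw [card_common_higmanSimsGraph huv, if_neg hn]

end SimpleGraph

/-! ### Six-sets meeting the sixteen basic blocks evenly -/

namespace SteinerHexad

/-- The fifteen partitions of a six-element set into pairs, as fixed-point-free involutions. -/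
def syntheme : Fin 15 → Fin 6 → Fin 6 :=
  ![![1, 0, 3, 2, 5, 4],
    ![1, 0, 4, 5, 2, 3],
    ![1, 0, 5, 4, 3, 2],
    ![2, 3, 0, 1, 5, 4],
    ![2, 4, 0, 5, 1, 3],
    ![2, 5, 0, 4, 3, 1],
    ![3, 2, 1, 0, 5, 4],
    ![3, 4, 5, 0, 1, 2],
    ![3, 5, 4, 0, 2, 1],
    ![4, 2, 1, 5, 0, 3],
    ![4, 3, 5, 1, 0, 2],
    ![4, 5, 3, 2, 0, 1],
    ![5, 2, 1, 4, 3, 0],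
    ![5, 3, 4, 1, 2, 0],
    ![5, 4, 3, 2, 1, 0]]

/-- The points of a Steiner system `S(3, 6, 22)`, coordinatized by a block with labelled points
and a point `none` off this block; the remaining points are labelled by synthemes. -/
abbrev Point := Fin 6 ⊕ Option (Fin 15)

/-- Membership in the basic block. -/
def inHexad : Point → Bool
  | .inl _ => true
  | .inr _ => false

/-- Membership in the block through two points of the basic block and the point `none`. -/
def inPairBlock (i j : Fin 6) : Point → Bool
  | .inl k => k == i || k == j
  | .inr none => true
  | .inr (some s) => syntheme s i == j

/-- The pairs of points of the basic block. -/
def pairs : List (Fin 6 × Fin 6) :=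
  [(0, 1), (0, 2), (0, 3), (0, 4), (0, 5), (1, 2), (1, 3), (1, 4),
    (1, 5), (2, 3), (2, 4), (2, 5), (3, 4), (3, 5), (4, 5)]

theorem ne_of_mem_pairs : ∀ p ∈ pairs, p.1 ≠ p.2 := by decide

/-- The basic block and the fifteen blocks through `none` that meet it, which determine the
Steiner system. -/
def basicBlocks : List (Point → Bool) :=
  inHexad :: pairs.map fun p => inPairBlock p.1 p.2

/-- The list of all points. -/
def points : List Point :=
  (List.finRange 6).map .inl ++ .inr none :: (List.finRange 15).map (.inr ∘ some)

/-- The six-element sets of points that meet every basic block evenly. -/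
def hexads : Finset (Finset Point) :=
  {S | #S = 6 ∧ ∀ p ∈ basicBlocks, Even #{x ∈ S | p x}}

/-- The sum modulo two of the columns selected by a list of bits. -/
def syndrome : List ℕ → List Bool → ℕ
  | c :: cs, true :: l => c ^^^ syndrome cs l
  | _ :: cs, false :: l => syndrome cs l
  | _, _ => 0

/-- Bitwise disjunction of a list of numerals. -/
def orAll : List ℕ → ℕ
  | [] => 0
  | c :: cs => c ||| orAll cs

/-- All selections of `w` columns with sum `s`. -/
def search : List ℕ → ℕ → ℕ → List (List Bool)
  | [], s, w => bif s == 0 && w == 0 then [[]] else []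
  | c :: cs, s, w => bif (s ||| orAll (c :: cs)) == orAll (c :: cs) then
      (search cs s w).map (false :: ·) ++
        match w with
        | 0 => []
        | w + 1 => (search cs (s ^^^ c) w).map (true :: ·)
    else []

/-- A sum of columns has no bit outside their union, so the pruning test in `search` loses no
solution. -/
theorem syndrome_lor_orAll (cs : List ℕ) (l : List Bool) :
    syndrome cs l ||| orAll cs = orAll cs := by
  have key (k : ℕ) : (syndrome cs l).testBit k → (orAll cs).testBit k := by
    induction cs generalizing l with
    | nil => simp [syndrome]
    | cons c cs ih =>
      match l with
      | [] => simp [syndrome]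
      | true :: l =>
        simp only [syndrome, orAll, Nat.testBit_xor, Nat.testBit_or]
        have := ih l
        grind
      | false :: l =>
        simp only [syndrome, orAll, Nat.testBit_or]
        have := ih l
        grind
  refine Nat.eq_of_testBit_eq fun k => ?_
  have := key k
  rw [Nat.testBit_or]
  grind

theorem mem_search (cs : List ℕ) (l : List Bool) (h : l.length = cs.length) :
    l ∈ search cs (syndrome cs l) (l.count true) := by
  induction cs generalizing l with
  | nil =>
    obtain rfl : l = [] := by simpa using h
    simp [search, syndrome]
  | cons c cs ih =>
    match l with
    | true :: l =>
      rw [search.eq_def, List.count_cons_self]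
      simp only [syndrome_lor_orAll, beq_self_eq_true, cond_true]
      refine List.mem_append_right _ (List.mem_map_of_mem ?_)
      have : syndrome (c :: cs) (true :: l) ^^^ c = syndrome cs l := by
        rw [syndrome, Nat.xor_comm, ← Nat.xor_assoc, Nat.xor_self, Nat.zero_xor]
      rw [this]
      exact ih l (by simpa using h)
    | false :: l =>
      rw [search.eq_def]
      simp only [syndrome_lor_orAll, beq_self_eq_true, cond_true]
      refine List.mem_append_left _ (List.mem_map_of_mem ?_)
      simpa using! ih l (by simpa using h)

theorem testBit_syndrome {α : Type*} (is : List α) (c : α → ℕ) (x : α → Bool) (k : ℕ) :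
    (syndrome (is.map c) (is.map x)).testBit k
      = decide (Odd (is.countP fun i => x i && (c i).testBit k)) := by
  induction is with
  | nil => simp [syndrome]
  | cons i is ih =>
    simp only [List.map_cons, List.countP_cons]
    cases hx : x i
    · simp [syndrome, ih]
    · cases hc : (c i).testBit k <;> simp [syndrome, ih, hc, Nat.testBit_xor, Nat.odd_add_one,
        -Nat.not_odd_iff_even]

/-- The numeral whose `k`-th bit is the value of the `k`-th predicate. -/
def column {α : Type*} (ps : List (α → Bool)) (x : α) : ℕ :=
  ps.foldr (fun p n => 2 * n + (p x).toNat) 0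

theorem testBit_column {α : Type*} (ps : List (α → Bool)) (x : α) (k : ℕ) :
    (column ps x).testBit k = (ps.map (· x)).getD k false := by
  induction ps generalizing k with
  | nil => simp [column]
  | cons p ps ih =>
    change (2 * column ps x + (p x).toNat).testBit k = _
    cases k with
    | zero => cases h : p x <;> simp [h]
    | succ k =>
      rw [Nat.testBit_succ, show (2 * column ps x + (p x).toNat) / 2 = column ps x by
        have := (p x).toNat_le; omega, ih]
      simp

theorem countP_points (p : Point → Bool) : points.countP p = #{x | p x} := by
  have h : (univ : Finset Point) = ⟨points, by decide⟩ := by decide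
  rw [h, card_def, filter_val, ← Multiset.countP_eq_card_filter, Multiset.coe_countP]
  simp

theorem mem_points (x : Point) : x ∈ points := by
  rcases x with i | _ | s <;> simp [points]

theorem columns_points : points.map (column basicBlocks) =
    [63, 963, 7237, 25737, 43281, 53793, 65534, 33794, 18434, 12290, 32900, 16644,
      8708, 32840, 4360, 2568, 16464, 4240, 1552, 8288, 2208, 1312] := by
  decide +kernel

theorem length_search_columns : (search (points.map (column basicBlocks)) 0 6).length = 77 := by
  rw [columns_points]
  decide +kernel

/-- The incidences of points with basic blocks form a parity-check matrix; a hexad is a selection of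
six columns with sum zero modulo two, and `search` finds all of these. -/
theorem card_hexads_le : #hexads ≤ 77 := by
  have hmaps : ∀ S ∈ hexads, points.map (fun x => decide (x ∈ S))
      ∈ (search (points.map (column basicBlocks)) 0 6).toFinset := by
    intro S hS
    obtain ⟨hcard, heven⟩ := (mem_filter.1 hS).2
    rw [List.mem_toFinset]
    have hsyn : syndrome (points.map (column basicBlocks)) (points.map fun x => decide (x ∈ S))
        = 0 := by
      refine Nat.eq_of_testBit_eq fun k => ?_
      rw [testBit_syndrome, countP_points, Nat.zero_testBit, decide_eq_false_iff_not,
        Nat.not_odd_iff_even]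
      by_cases hk : k < basicBlocks.length
      · convert heven _ (List.getElem_mem hk) using 2
        ext x
        simp [testBit_column, hk]
      · rw [filter_eq_empty_iff.2, card_empty]
        · exact Even.zero
        intro x _
        simp [testBit_column, List.getElem?_eq_none (not_lt.1 hk)]
    have hcount : (points.map fun x => decide (x ∈ S)).count true = 6 := by
      refine Eq.trans ?_ hcard
      rw [List.count, List.countP_map, countP_points]
      congr 1
      ext x
      simp
    have := mem_search (points.map (column basicBlocks)) (points.map fun x => decide (x ∈ S))
      (by simp)
    rwa [hsyn, hcount] at this
  have hinj : Set.InjOn (fun S : Finset Point => points.map fun x => decide (x ∈ S)) hexads := by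
    intro S _ T _ h
    ext x
    have := List.map_inj_left.1 h x (mem_points x)
    simpa using this
  calc #hexads ≤ #(search (points.map (column basicBlocks)) 0 6).toFinset :=
        card_le_card_of_injOn _ hmaps hinj
    _ ≤ 77 := (List.toFinset_card_le _).trans length_search_columns.le

end SteinerHexad

/-! ### Coordinates on the neighbourhood of a vertex -/

namespace SimpleGraph

open SteinerHexad

variable {V : Type*} [Fintype V] [DecidableEq V] {G : SimpleGraph V} [DecidableRel G.Adj]

theorem IsSRGWith.card_common_blocks [Nonempty V] (h : G.IsSRGWith 100 22 0 6) {x₀ w w' x : V}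
    (hww : w ≠ w') (hw : w ≠ x₀) (hw' : w' ≠ x₀) (hx : G.Adj x₀ x) (hwx : G.Adj w x)
    (hwx' : G.Adj w' x) : #{v | G.Adj v x₀ ∧ G.Adj v w ∧ G.Adj v w'} = 2 :=
  h.card_common_three hw.symm hw'.symm hww (h.not_adj_of_common hx.symm hwx.symm)
    (h.not_adj_of_common hx.symm hwx'.symm) (h.not_adj_of_common hwx.symm hwx'.symm)

theorem IsSRGWith.card_blocks_through [Nonempty V] (h : G.IsSRGWith 100 22 0 6) {x₀ x y z : V}
    (hxy : x ≠ y) (hxz : x ≠ z) (hyz : y ≠ z) (hx : G.Adj x₀ x) (hy : G.Adj x₀ y)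
    (hz : G.Adj x₀ z) : #{w | G.Adj w x ∧ G.Adj w y ∧ G.Adj w z} = 2 :=
  h.card_common_three hxy hxz hyz (h.not_adj_of_common hx hy) (h.not_adj_of_common hx hz)
    (h.not_adj_of_common hy hz)

/-- One of the two common neighbours of the three points is `x₀`; the other is the block through
them. -/
theorem IsSRGWith.exists_block [Nonempty V] (h : G.IsSRGWith 100 22 0 6) {x₀ x y z : V}
    (hxy : x ≠ y) (hxz : x ≠ z) (hyz : y ≠ z) (hx : G.Adj x₀ x) (hy : G.Adj x₀ y)
    (hz : G.Adj x₀ z) : ∃ w, w ≠ x₀ ∧ G.Adj w x ∧ G.Adj w y ∧ G.Adj w z := by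
  have hc := h.card_blocks_through hxy hxz hyz hx hy hz
  obtain ⟨w, hw, hne⟩ := exists_mem_ne (by rw [hc]; norm_num) x₀
  exact ⟨w, hne, by simpa using hw⟩

theorem IsSRGWith.block_unique [Nonempty V] (h : G.IsSRGWith 100 22 0 6) {x₀ x y z w w' : V}
    (hxy : x ≠ y) (hxz : x ≠ z) (hyz : y ≠ z) (hx : G.Adj x₀ x) (hy : G.Adj x₀ y)
    (hz : G.Adj x₀ z) (hw : w ≠ x₀) (hw' : w' ≠ x₀) (wx : G.Adj w x) (wy : G.Adj w y)
    (wz : G.Adj w z) (wx' : G.Adj w' x) (wy' : G.Adj w' y) (wz' : G.Adj w' z) : w = w' := by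
  by_contra hne
  have hc := h.card_blocks_through hxy hxz hyz hx hy hz
  have hsub : {x₀, w, w'} ⊆ ({w | G.Adj w x ∧ G.Adj w y ∧ G.Adj w z} : Finset V) := by
    intro v hv
    simp only [mem_insert, mem_singleton] at hv
    rcases hv with rfl | rfl | rfl <;> simp [*]
  have := card_le_card hsub
  rw [hc, card_eq_three.2 ⟨x₀, w, w', hw.symm, hw'.symm, hne, rfl⟩] at this
  omega

/-- A coordinatization of the neighbourhood of `x₀`. -/
structure IsFrame (G : SimpleGraph V) (x₀ : V) (P : Point → V) : Prop where
  injective : Function.Injective P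
  adj : ∀ i, G.Adj x₀ (P i)
  exists_block : ∀ p ∈ basicBlocks, ∃ w, w ≠ x₀ ∧ ¬ G.Adj x₀ w ∧ ∀ i, G.Adj w (P i) ↔ p i

/-- A point of the basic block outside the first pair of a syntheme. -/
def secondPoint (s : Fin 15) : Fin 6 := if syntheme s 0 = 1 then 2 else 1

theorem syntheme_ne : ∀ s i, i ≠ syntheme s i := by decide

theorem syntheme_syntheme : ∀ s i, syntheme s (syntheme s i) = i := by decide

theorem syntheme_injective : Function.Injective syntheme := by decide

theorem secondPoint_disjoint : ∀ s k, k = 0 ∨ k = syntheme s 0 →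
    ¬ (k = secondPoint s ∨ k = syntheme s (secondPoint s)) := by decide

theorem eq_syntheme_of_not_mem : ∀ s m x, x ≠ m → ¬ (m = 0 ∨ m = syntheme s 0) →
    ¬ (m = secondPoint s ∨ m = syntheme s (secondPoint s)) → ¬ (x = 0 ∨ x = syntheme s 0) →
    ¬ (x = secondPoint s ∨ x = syntheme s (secondPoint s)) → x = syntheme s m := by decide

/-- Take a block `w₀` with points `p i` and a point `q` off it; `b i j` is the block through `p i`,
`p j`, `q`. For any further point, the blocks joining it to `q` and some `p i` split the six points
into pairs, which is why synthemes serve as labels. The proof builds, for each syntheme `s`, a point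
`r s` with these incidences. -/
theorem IsSRGWith.exists_isFrame [Nonempty V] (h : G.IsSRGWith 100 22 0 6) (x₀ : V) :
    ∃ P, G.IsFrame x₀ P := by
  have hdeg : #{v | G.Adj x₀ v} = 22 := by
    rw [← h.regular x₀, degree, neighborFinset_eq_filter]
  obtain ⟨w₀, hw₀, hxw₀⟩ : ∃ w₀, w₀ ≠ x₀ ∧ ¬ G.Adj x₀ w₀ := by
    by_contra! hc
    have h1 : (univ : Finset V) ⊆ insert x₀ ({v | G.Adj x₀ v} : Finset V) := by
      intro v _
      by_cases hv : v = x₀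
      · simp [hv]
      · simp [hc v hv]
    have h2 := card_le_card h1
    have h3 := card_insert_le x₀ ({v | G.Adj x₀ v} : Finset V)
    rw [card_univ, h.card] at h2
    omega
  have hC : #{v | G.Adj x₀ v ∧ G.Adj w₀ v} = 6 := by
    rw [← card_commonNeighbors_eq_card_filter, h.of_not_adj hw₀.symm hxw₀]
  obtain ⟨p, hpinj, hxp, hwp, hpsurj⟩ : ∃ p : Fin 6 → V, Function.Injective p ∧
      (∀ i, G.Adj x₀ (p i)) ∧ (∀ i, G.Adj w₀ (p i)) ∧
      ∀ v, G.Adj x₀ v → G.Adj w₀ v → ∃ i, p i = v := by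
    have e := (Finset.equivFinOfCardEq hC).symm
    refine ⟨fun i => (e i).1, Subtype.val_injective.comp e.injective, fun i => ?_, fun i => ?_,
      fun v h1 h2 => ⟨e.symm ⟨v, by simp [h1, h2]⟩, by simp⟩⟩
    · exact (mem_filter.1 (e i).2).2.1
    · exact (mem_filter.1 (e i).2).2.2
  obtain ⟨q, hxq, hwq⟩ : ∃ q, G.Adj x₀ q ∧ ¬ G.Adj w₀ q := by
    by_contra! hc
    have : #{v | G.Adj x₀ v} ≤ #{v | G.Adj x₀ v ∧ G.Adj w₀ v} :=
      card_le_card fun v hv => by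
        have hv := (mem_filter.1 hv).2
        simp [hv, hc v hv]
    omega
  have hqp (i) : p i ≠ q := fun hi => hwq (hi ▸ hwp i)
  have hb (i j : Fin 6) : ∃ w, i ≠ j →
      w ≠ x₀ ∧ G.Adj w (p i) ∧ G.Adj w (p j) ∧ G.Adj w q := by
    by_cases hij : i = j
    -- A default value, so that `b` is total; the diagonal is never used.
    · exact ⟨x₀, fun hne => absurd hij hne⟩
    · obtain ⟨w, hw⟩ := h.exists_block (hpinj.ne hij) (hqp i) (hqp j) (hxp i) (hxp j) hxq
      exact ⟨w, fun _ => hw⟩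
  choose b hb using hb
  have hbuniq {i j : Fin 6} (hij : i ≠ j) {w : V} (hw : w ≠ x₀) (wi : G.Adj w (p i))
      (wj : G.Adj w (p j)) (wq : G.Adj w q) : w = b i j := by
    obtain ⟨b0, b1, b2, b3⟩ := hb i j hij
    exact h.block_unique (hpinj.ne hij) (hqp i) (hqp j) (hxp i) (hxp j) hxq hw b0 wi wj wq b1 b2 b3
  have hbsymm {i j : Fin 6} (hij : i ≠ j) : b i j = b j i := by
    obtain ⟨b0, b1, b2, b3⟩ := hb i j hij
    exact hbuniq hij.symm b0 b2 b1 b3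
  have hbp {i j : Fin 6} (hij : i ≠ j) (k : Fin 6) : G.Adj (b i j) (p k) ↔ k = i ∨ k = j := by
    obtain ⟨b0, b1, b2, b3⟩ := hb i j hij
    refine ⟨fun bk => ?_, ?_⟩
    · by_contra! hk
      have := h.block_unique (hpinj.ne hij) (hpinj.ne hk.1.symm) (hpinj.ne hk.2.symm) (hxp i)
        (hxp j) (hxp k) b0 hw₀ b1 b2 bk (hwp i) (hwp j) (hwp k)
      exact hwq (this ▸ b3)
    · rintro (rfl | rfl) <;> assumption
  -- Blocks through two pairs of `s` share `q`, hence exactly one more point, which is taken as `r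
  -- s`.
  have hr (s : Fin 15) : ∃ r, r ≠ q ∧ G.Adj x₀ r ∧ G.Adj (b 0 (syntheme s 0)) r ∧
      G.Adj (b (secondPoint s) (syntheme s (secondPoint s))) r := by
    obtain ⟨b0, b1, b2, b3⟩ := hb 0 _ (syntheme_ne s 0)
    obtain ⟨c0, c1, c2, c3⟩ := hb _ _ (syntheme_ne s (secondPoint s))
    have hne : b 0 (syntheme s 0) ≠ b (secondPoint s) (syntheme s (secondPoint s)) := by
      intro he
      rw [he, hbp (syntheme_ne s _)] at b1
      exact secondPoint_disjoint s 0 (Or.inl rfl) b1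
    have hc := h.card_common_blocks hne b0 c0 hxq b3 c3
    obtain ⟨r, hr, hrq⟩ := exists_mem_ne (by rw [hc]; norm_num) q
    have hr := (mem_filter.1 hr).2
    exact ⟨r, hrq, hr.1.symm, hr.2.1.symm, hr.2.2.symm⟩
  choose r hrq hxr hr1 hr2 using hr
  have hrp (s k) : p k ≠ r s := by
    intro hk
    have h1 := hr1 s
    have h2 := hr2 s
    rw [← hk, hbp (syntheme_ne s _)] at h1 h2
    exact secondPoint_disjoint s k h1 h2
  have hbr' {i j : Fin 6} (hij : i ≠ j) {i' j' : Fin 6} (hij' : i' ≠ j') {s : Fin 15} {k : Fin 6}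
      (h1 : G.Adj (b i j) (r s)) (h2 : G.Adj (b i' j') (r s)) (hk : k = i ∨ k = j)
      (hk' : k = i' ∨ k = j') : b i j = b i' j' :=
    h.block_unique (hqp k) (hrp s k) (hrq s).symm (hxp k) hxq (hxr s) (hb i j hij).1
      (hb i' j' hij').1 ((hbp hij k).2 hk) (hb i j hij).2.2.2 h1 ((hbp hij' k).2 hk')
      (hb i' j' hij').2.2.2 h2
  have hbr (s m) : G.Adj (b m (syntheme s m)) (r s) := by
    have hsymm (i) : b (syntheme s i) i = b i (syntheme s i) := (hbsymm (syntheme_ne s i)).symm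
    by_cases hm1 : m = 0 ∨ m = syntheme s 0
    · rcases hm1 with rfl | rfl
      · exact hr1 s
      · rw [syntheme_syntheme, hsymm]
        exact hr1 s
    by_cases hm2 : m = secondPoint s ∨ m = syntheme s (secondPoint s)
    · rcases hm2 with rfl | rfl
      · exact hr2 s
      · rw [syntheme_syntheme, hsymm]
        exact hr2 s
    -- For `m` in the third pair, the block through `p m`, `q`, `r s` meets `w₀` in one more point
    -- `p x`. If `x` lay in one of the first two pairs, this block would be that pair's block, which
    -- misses `p m`; so `x` is the partner of `m`.
    obtain ⟨w, hw, wp, wq, wr⟩ :=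
      h.exists_block (hqp m) (hrp s m) (hrq s).symm (hxp m) hxq (hxr s)
    have hww : w ≠ w₀ := fun he => hwq (he ▸ wq)
    have hc := h.card_common_blocks hww hw hw₀ (hxp m) wp (hwp m)
    obtain ⟨v, hv, hvp⟩ := exists_mem_ne (by rw [hc]; norm_num) (p m)
    obtain ⟨hv1, hv2, hv3⟩ := (mem_filter.1 hv).2
    obtain ⟨x, rfl⟩ := hpsurj v hv1.symm hv3.symm
    have hxm : x ≠ m := fun he => hvp (he ▸ rfl)
    have hwb := hbuniq hxm.symm hw wp hv2.symm wq
    have hout (i : Fin 6) (hi : G.Adj (b i (syntheme s i)) (r s))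
        (hm : ¬ (m = i ∨ m = syntheme s i)) : ¬ (x = i ∨ x = syntheme s i) := by
      intro hx
      have := hbr' hxm.symm (syntheme_ne s i) (hwb ▸ wr) hi (Or.inr rfl) hx
      rw [← hwb] at this
      exact hm ((hbp (syntheme_ne s i) m).1 (this ▸ wp))
    have hx := eq_syntheme_of_not_mem s m x hxm hm1 hm2 (hout 0 (hr1 s) hm1) (hout _ (hr2 s) hm2)
    rw [← hx, ← hwb]
    exact wr
  have hbr_iff {i j : Fin 6} (hij : i ≠ j) (s) : G.Adj (b i j) (r s) ↔ syntheme s i = j := by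
    refine ⟨fun h1 => ?_, fun h1 => h1 ▸ hbr s i⟩
    by_contra hne
    have := hbr' hij (syntheme_ne s i) h1 (hbr s i) (Or.inl rfl) (Or.inl rfl)
    have h2 := (hb i j hij).2.2.1
    rw [this, hbp (syntheme_ne s i)] at h2
    rcases h2 with h2 | h2
    · exact hij h2.symm
    · exact hne h2.symm
  have hrinj : Function.Injective r := by
    intro s t hst
    refine syntheme_injective (funext fun i => ?_)
    have := hbr s i
    rw [hst, hbr_iff (syntheme_ne s i)] at this
    exact this.symm
  have hwr (s) : ¬ G.Adj w₀ (r s) := fun hs => by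
    obtain ⟨i, hi⟩ := hpsurj _ (hxr s) hs
    exact hrp s i hi
  refine ⟨Sum.elim p fun o => o.elim q r, ?_, ?_, ?_⟩
  · rintro (i | _ | s) (j | _ | t) hij <;> simp at hij ⊢
    · exact hpinj hij
    · exact hqp _ hij
    · exact hrp _ _ hij
    · exact hqp _ hij.symm
    · exact hrq _ hij.symm
    · exact hrp _ _ hij.symm
    · exact hrq _ hij
    · exact hrinj hij
  · rintro (i | _ | s)
    exacts [hxp i, hxq, hxr s]
  · intro B hB
    rcases List.mem_cons.1 hB with rfl | hB
    · refine ⟨w₀, hw₀, hxw₀, ?_⟩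
      rintro (i | _ | s) <;> simp [inHexad, *]
    · obtain ⟨⟨i, j⟩, hij, rfl⟩ := List.mem_map.1 hB
      have hij := ne_of_mem_pairs _ hij
      refine ⟨b i j, (hb i j hij).1,
        h.not_adj_of_common hxq.symm (hb i j hij).2.2.2.symm, ?_⟩
      rintro (k | _ | s)
      · simp [inPairBlock, hbp hij]
      · simp [inPairBlock, (hb i j hij).2.2.2]
      · simp [inPairBlock, hbr_iff hij]

/-! ### Reconstruction of the graph and uniqueness -/

/-- The points that are adjacent to a given vertex. -/
def trace (G : SimpleGraph V) [DecidableRel G.Adj] (P : Point → V) (w : V) : Finset Point :=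
  {i | G.Adj w (P i)}

/-- The code of a vertex with respect to a coordinatization of the neighbourhood of `x₀`. -/
noncomputable def code (G : SimpleGraph V) [DecidableRel G.Adj] (x₀ : V) (P : Point → V) (v : V) :
    Option (Point ⊕ Finset Point) :=
  open scoped Classical in
  if v = x₀ then none
  else if h : ∃ i, P i = v then some (.inl h.choose)
  else some (.inr (G.trace P v))

/-- Adjacency of vertices in terms of their codes. -/
def codeAdj : Option (Point ⊕ Finset Point) → Option (Point ⊕ Finset Point) → Prop
  | none, some (.inl _) => True
  | some (.inl _), none => True
  | some (.inl i), some (.inr S) => i ∈ S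
  | some (.inr S), some (.inl i) => i ∈ S
  | some (.inr S), some (.inr T) => Disjoint S T
  | _, _ => False

/-- The codes that can occur. -/
def codes : Finset (Option (Point ⊕ Finset Point)) :=
  insertNone (univ.disjSum hexads)

theorem card_codes_le : #codes ≤ 100 := by
  have := card_hexads_le
  rw [codes, card_insertNone, card_disjSum, card_univ]
  simp only [Fintype.card_sum, Fintype.card_option, Fintype.card_fin]
  omega

namespace IsFrame

variable {x₀ : V} {P : Point → V}

theorem exists_eq (hP : G.IsFrame x₀ P) (h : G.IsSRGWith 100 22 0 6) {v : V} (hv : G.Adj x₀ v) :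
    ∃ i, P i = v := by
  have hsub : univ.image P ⊆ ({v | G.Adj x₀ v} : Finset V) := by
    intro v hv
    obtain ⟨i, -, rfl⟩ := mem_image.1 hv
    simpa using hP.adj i
  have heq := eq_of_subset_of_card_le hsub (by
    rw [card_image_of_injective _ hP.injective, card_univ, ← neighborFinset_eq_filter,
      card_neighborFinset_eq_degree, h.regular x₀]
    simp)
  have : v ∈ univ.image P := by rw [heq]; simpa using hv
  simpa using this

theorem card_filter (hP : G.IsFrame x₀ P) (h : G.IsSRGWith 100 22 0 6) (Q : V → Prop)
    [DecidablePred Q] : #{i | Q (P i)} = #{v | G.Adj x₀ v ∧ Q v} := by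
  rw [← card_image_of_injective _ hP.injective]
  congr 1
  ext v
  simp only [mem_image, mem_filter, mem_univ, true_and]
  constructor
  · rintro ⟨i, hi, rfl⟩
    exact ⟨hP.adj i, hi⟩
  · rintro ⟨hv, hQ⟩
    obtain ⟨i, rfl⟩ := hP.exists_eq h hv
    exact ⟨i, hQ, rfl⟩

theorem card_trace (hP : G.IsFrame x₀ P) (h : G.IsSRGWith 100 22 0 6) {w : V} (hw : w ≠ x₀)
    (hxw : ¬ G.Adj x₀ w) : #(G.trace P w) = 6 := by
  rw [trace, hP.card_filter h fun v => G.Adj w v, ← card_commonNeighbors_eq_card_filter,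
    h.of_not_adj hw.symm hxw]

theorem disjoint_trace (h : G.IsSRGWith 100 22 0 6) {w w' : V} (hww : G.Adj w w') :
    Disjoint (G.trace P w) (G.trace P w') := by
  rw [Finset.disjoint_left]
  intro i hi hi'
  simp only [trace, mem_filter, mem_univ, true_and] at hi hi'
  exact h.not_adj_of_common hi.symm hi'.symm hww

theorem card_trace_inter [Nonempty V] (hP : G.IsFrame x₀ P) (h : G.IsSRGWith 100 22 0 6)
    {w w' : V} (hw : w ≠ x₀) (hxw : ¬ G.Adj x₀ w) (hw' : w' ≠ x₀) (hxw' : ¬ G.Adj x₀ w')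
    (hne : w ≠ w') (hww : ¬ G.Adj w w') : #(G.trace P w ∩ G.trace P w') = 2 := by
  rw [← h.card_common_three hw.symm hw'.symm hne hxw hxw' hww]
  simp only [trace, ← filter_and]
  rw [hP.card_filter h fun v => G.Adj w v ∧ G.Adj w' v]
  simp only [G.adj_comm]

/-- Adjacent vertices share no neighbour, while distinct non-adjacent ones have two common
neighbours inside the neighbourhood of `x₀`. -/
theorem adj_iff_disjoint_trace [Nonempty V] (hP : G.IsFrame x₀ P) (h : G.IsSRGWith 100 22 0 6)
    {w w' : V} (hw : w ≠ x₀) (hxw : ¬ G.Adj x₀ w) (hw' : w' ≠ x₀) (hxw' : ¬ G.Adj x₀ w') :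
    G.Adj w w' ↔ Disjoint (G.trace P w) (G.trace P w') := by
  refine ⟨disjoint_trace h, fun hd => ?_⟩
  by_contra hww
  rcases eq_or_ne w w' with rfl | hne
  · have := hP.card_trace h hw hxw
    rw [disjoint_self.1 hd] at this
    simp at this
  · have := hP.card_trace_inter h hw hxw hw' hxw' hne hww
    rw [disjoint_iff_inter_eq_empty.1 hd] at this
    simp at this

theorem eq_of_trace_eq [Nonempty V] (hP : G.IsFrame x₀ P) (h : G.IsSRGWith 100 22 0 6)
    {w w' : V} (hw : w ≠ x₀) (hxw : ¬ G.Adj x₀ w) (hw' : w' ≠ x₀) (hxw' : ¬ G.Adj x₀ w')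
    (heq : G.trace P w = G.trace P w') : w = w' := by
  by_contra hne
  have h6 := hP.card_trace h hw hxw
  by_cases hww : G.Adj w w'
  · have := disjoint_trace (P := P) h hww
    rw [← heq, disjoint_self] at this
    rw [this] at h6
    simp at h6
  · have := hP.card_trace_inter h hw hxw hw' hxw' hne hww
    rw [← heq, inter_self] at this
    omega

/-- Each basic block is itself the trace of a vertex, and two traces meet in 0, 2 or 6 points. -/
theorem trace_mem_hexads [Nonempty V] (hP : G.IsFrame x₀ P) (h : G.IsSRGWith 100 22 0 6)
    {w : V} (hw : w ≠ x₀) (hxw : ¬ G.Adj x₀ w) : G.trace P w ∈ hexads := by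
  refine mem_filter.2 ⟨mem_univ _, hP.card_trace h hw hxw, fun p hp => ?_⟩
  obtain ⟨g, hg, hxg, hgP⟩ := hP.exists_block p hp
  have : ({x ∈ G.trace P w | p x} : Finset Point) = G.trace P w ∩ G.trace P g := by
    ext i
    simp [trace, hgP]
  rw [this]
  by_cases hwg : G.Adj w g
  · simp [disjoint_iff_inter_eq_empty.1 (disjoint_trace (P := P) h hwg)]
  rcases eq_or_ne w g with rfl | hne
  · rw [inter_self, hP.card_trace h hw hxw]
    decide
  · rw [hP.card_trace_inter h hw hxw hg hxg hne hwg]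
    decide

theorem code_self : G.code x₀ P x₀ = none := by simp [code]

theorem code_point (hP : G.IsFrame x₀ P) (i : Point) : G.code x₀ P (P i) = some (.inl i) := by
  have hi : ∃ j, P j = P i := ⟨i, rfl⟩
  rw [code, if_neg (hP.adj i).ne', dif_pos hi, hP.injective hi.choose_spec]

theorem code_block (hP : G.IsFrame x₀ P) {w : V} (hw : w ≠ x₀) (hxw : ¬ G.Adj x₀ w) :
    G.code x₀ P w = some (.inr (G.trace P w)) := by
  rw [code, if_neg hw, dif_neg]
  rintro ⟨i, rfl⟩
  exact hxw (hP.adj i)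

theorem trichotomy (hP : G.IsFrame x₀ P) (h : G.IsSRGWith 100 22 0 6) (v : V) :
    v = x₀ ∨ (∃ i, v = P i) ∨ (v ≠ x₀ ∧ ¬ G.Adj x₀ v) := by
  by_cases h0 : v = x₀
  · exact Or.inl h0
  by_cases h1 : G.Adj x₀ v
  · obtain ⟨i, hi⟩ := hP.exists_eq h h1
    exact Or.inr (Or.inl ⟨i, hi.symm⟩)
  · exact Or.inr (Or.inr ⟨h0, h1⟩)

theorem adj_iff_codeAdj [Nonempty V] (hP : G.IsFrame x₀ P) (h : G.IsSRGWith 100 22 0 6) (u v : V) :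
    G.Adj u v ↔ codeAdj (G.code x₀ P u) (G.code x₀ P v) := by
  have hxP := hP.adj
  have hPx (i) : G.Adj (P i) x₀ := (hP.adj i).symm
  have hPP (i j) : ¬ G.Adj (P i) (P j) := h.not_adj_of_common (hP.adj i) (hP.adj j)
  rcases hP.trichotomy h u with rfl | ⟨i, rfl⟩ | ⟨hu, hxu⟩ <;>
    rcases hP.trichotomy h v with rfl | ⟨j, rfl⟩ | ⟨hv, hxv⟩
  · simp [code_self, codeAdj]
  · simp [code_self, hP.code_point, codeAdj, hxP]
  · simp [code_self, hP.code_block, codeAdj, *]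
  · simp [code_self, hP.code_point, codeAdj, hPx]
  · simp [hP.code_point, codeAdj, hPP]
  · rw [hP.code_point, hP.code_block hv hxv]
    simp [codeAdj, trace, G.adj_comm]
  · have : ¬ G.Adj u v := fun h => hxu h.symm
    simp [code_self, hP.code_block hu hxu, codeAdj, this]
  · rw [hP.code_point, hP.code_block hu hxu]
    simp [codeAdj, trace]
  · rw [hP.code_block hu hxu, hP.code_block hv hxv]
    exact hP.adj_iff_disjoint_trace h hu hxu hv hxv

theorem code_injective [Nonempty V] (hP : G.IsFrame x₀ P) (h : G.IsSRGWith 100 22 0 6) :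
    Function.Injective (G.code x₀ P) := by
  intro u v huv
  rcases hP.trichotomy h u with rfl | ⟨i, rfl⟩ | ⟨hu, hxu⟩ <;>
    rcases hP.trichotomy h v with rfl | ⟨j, rfl⟩ | ⟨hv, hxv⟩ <;>
    simp [code_self, hP.code_point, hP.code_block, *] at huv ⊢
  · exact congrArg P huv
  · exact hP.eq_of_trace_eq h hu hxu hv hxv huv

/-- The 100 vertices have distinct codes among at most 100 candidates, so every candidate occurs.
The set of codes is thus the same for all graphs with these parameters. -/
theorem image_code [Nonempty V] (hP : G.IsFrame x₀ P) (h : G.IsSRGWith 100 22 0 6) :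
    univ.image (G.code x₀ P) = codes := by
  refine eq_of_subset_of_card_le ?_ ?_
  · intro c hc
    obtain ⟨v, -, rfl⟩ := mem_image.1 hc
    rcases hP.trichotomy h v with rfl | ⟨i, rfl⟩ | ⟨hv, hxv⟩
    · simp [code_self, codes]
    · simp [hP.code_point, codes]
    · simp [hP.code_block hv hxv, codes, hP.trace_mem_hexads h hv hxv]
  · rw [card_image_of_injective _ (hP.code_injective h), card_univ, h.card]
    exact card_codes_le

end IsFrame

/-- The strongly regular graph with parameters `(100, 22, 0, 6)` is unique. -/
theorem IsSRGWith.nonempty_iso {W : Type*} [Fintype W] [DecidableEq W] {H : SimpleGraph W}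
    [DecidableRel H.Adj] [Nonempty V] [Nonempty W] (hG : G.IsSRGWith 100 22 0 6)
    (hH : H.IsSRGWith 100 22 0 6) : Nonempty (G ≃g H) := by
  obtain ⟨P, hP⟩ := hG.exists_isFrame (Classical.arbitrary V)
  obtain ⟨Q, hQ⟩ := hH.exists_isFrame (Classical.arbitrary W)
  -- The isomorphism pairs vertices with equal codes.
  have key (v : V) :
      ∃ w, H.code (Classical.arbitrary W) Q w = G.code (Classical.arbitrary V) P v := by
    have : G.code (Classical.arbitrary V) P v ∈ univ.image (H.code (Classical.arbitrary W) Q) := by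
      rw [hQ.image_code hH, ← hP.image_code hG]
      exact mem_image_of_mem _ (mem_univ v)
    simpa using this
  choose f hf using key
  have hinj : Function.Injective f := fun u v huv =>
    hP.code_injective hG (by rw [← hf, ← hf, huv])
  have hbij : Function.Bijective f :=
    (Fintype.bijective_iff_injective_and_card f).2 ⟨hinj, hG.card.trans hH.card.symm⟩
  exact ⟨⟨Equiv.ofBijective f hbij, fun {u v} => by
    rw [hP.adj_iff_codeAdj hG, hQ.adj_iff_codeAdj hH, Equiv.ofBijective_apply,
      Equiv.ofBijective_apply, hf, hf]⟩⟩

end SimpleGraph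

/-- Let `G` be a triangle-free strongly regular graph on `n` vertices. Then `μ₁ + μₙ ≤ 0.14 n`,
with equality if and only if `G` is (isomorphic to) the Higman–Sims graph. -/
theorem theorem2 {V : Type*} [Fintype V] [DecidableEq V] [Nonempty V] (G : SimpleGraph V)
    [DecidableRel G.Adj] (n k a b : ℕ) (hG : G.IsSRGWith n k a b) (htri : G.CliqueFree 3) :
    G.adjEigenvalueFirst + G.adjEigenvalueLast ≤ 0.14 * (n : ℝ) ∧
      (G.adjEigenvalueFirst + G.adjEigenvalueLast = 0.14 * (n : ℝ) ↔
        Nonempty (G ≃g SimpleGraph.higmanSimsGraph)) := by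
  obtain ⟨b', hb', h⟩ := hG.exists_le_of_cliqueFree htri
  obtain ⟨hle, heq⟩ := h.adjEigenvalueFirst_add_adjEigenvalueLast_le hb'
  refine ⟨hle, fun he => ?_, fun ⟨e⟩ => ?_⟩
  · obtain ⟨rfl, rfl, rfl⟩ := heq he
    exact h.nonempty_iso SimpleGraph.higmanSimsGraph_isSRGWith
  · have hS := SimpleGraph.higmanSimsGraph_isSRGWith.of_iso e
    obtain rfl : n = 100 := hG.card.symm.trans hS.card
    rw [hS.adjEigenvalueFirst_add_adjEigenvalueLast_eq]
    norm_num
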